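/- Let $n\ge 1$, $0<\alpha<n$, $2\le p<2n/\alpha$ and $A\ge 0$. For $S\subset\mathbb R^n$ let $\mathcal M^{*\alpha}(S)=\limsup_{\varepsilon\to0^+}(2\varepsilon)^{\alpha-n}|S(\varepsilon)|$ be its $\alpha$-dimensional upper Minkowski content, where $|S(\varepsilon)|$ is the Lebesgue measure of $S(\varepsilon)=\{x:\inf_{y\in S}|x-y|<\varepsilon\}$. There is a finite constant $C$, depending only on $n,\alpha,p$ and $A$, such that the following holds. Let $\nu$ be a non-zero finite Radon measure on $\mathbb R^n$ supported in a compact set $E$ (that is, $\nu(\mathbb R^n\setminus E)=0$) such that $0<\mathcal M^{*\alpha}(S)\le A\,\nu(S)$ for every compact $S\subset E$ with $\nu(S)\ne0$. Let $u$ be a tempered distribution on $\mathbb R^n$ with support contained in $E$ such that $$\limsup_{L\to\infty}\frac1{L^{n-\alpha p/2}}\int_{|\xi|\le L}|\widehat u(\xi)|^p\,d\xi<\infty .$$ Then there is $u_0\in L^2(\nu)$ with $u=u_0\,d\nu$, that is, $\langle u,\varphi\rangle=\int_E\varphi\,u_0\,d\nu$ for every Schwartz function $\varphi$, and $$\Big(\int_E|u_0|^2\,d\nu\Big)^{p/2}\le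 C\,\limsup_{L\to\infty}\frac1{L^{n-\alpha p/2}}\int_{|\xi|\le L}|\widehat u(\xi)|^p\,d\xi<\infty .$$ Here $\widehat u(\xi)=\langle u, e^{-2\pi i x\cdot\xi}\rangle$ is the Fourier transform of $u$, which is a function because $u$ has compact support. -/

import Mathlib

open MeasureTheory Filter Topology Set SchwartzMap FourierTransform
open scoped ENNReal NNReal

noncomputable section

/-- The `s`-dimensional upper Minkowski content of `A ⊆ ℝⁿ`, namely
`limsup_{ε → 0+} (2ε)^{s-n} |A(ε)|`, where `A(ε)` is the set of points at distance less than `ε`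
from `A`. -/
def upperMinkowskiContent {n : ℕ} (s : ℝ) (A : Set (EuclideanSpace ℝ (Fin n))) : ℝ≥0∞ :=
  limsup (fun ε : ℝ => ENNReal.ofReal ((2 * ε) ^ (s - (n : ℝ))) * volume (Metric.thickening ε A))
    (𝓝[>] 0)

/-- The tempered distribution `v` is (integration against) the locally integrable function `f`. -/
def IsFunctionDistribution {n : ℕ} (v : 𝓢'(EuclideanSpace ℝ (Fin n), ℂ))
    (f : EuclideanSpace ℝ (Fin n) → ℂ) : Prop :=
  LocallyIntegrable f volume ∧
    ∀ φ : 𝓢(EuclideanSpace ℝ (Fin n), ℂ), HasCompactSupport φ → v φ = ∫ ξ, φ ξ * f ξ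

/-- `∫_{|ξ| ≤ L} |v(ξ)|^p dξ` for a tempered distribution `v`. If `v` is a locally integrable
function then that function is unique up to null sets, so that the infimum is over one value;
if `v` is not a function the value is `∞`. -/
def lpMassOnBall {n : ℕ} (v : 𝓢'(EuclideanSpace ℝ (Fin n), ℂ)) (p L : ℝ) : ℝ≥0∞ :=
  ⨅ (f : EuclideanSpace ℝ (Fin n) → ℂ) (_ : IsFunctionDistribution v f),
    ∫⁻ ξ in Metric.closedBall 0 L, ‖f ξ‖ₑ ^ p

/-- `limsup_{L → ∞} L^{-(n - αp/2)} ∫_{|ξ| ≤ L} |û(ξ)|^p dξ`. -/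
def fourierLimsup {n : ℕ} (u : 𝓢'(EuclideanSpace ℝ (Fin n), ℂ)) (α p : ℝ) : ℝ≥0∞ :=
  limsup (fun L : ℝ => lpMassOnBall (𝓕 u) p L / ENNReal.ofReal (L ^ ((n : ℝ) - α * p / 2))) atTop

end

/-!
Mollify `u` at scale `ε` by a smooth `χ_ε` supported near the origin. By Parseval, `u (χ_ε * φ)`
pairs `û` with the product of the inverse transforms of `χ_ε` and `φ`. Cauchy-Schwarz, Plancherel
and a dyadic decomposition of frequency space then bound its square by a constant times
`ε ^ (-(n - α)) ∫ |φ|²`, as soon as `∫_{|ξ| ≤ L} |û|² = O(L ^ (n - α))`; this growth follows from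
the hypothesis on `|û| ^ p` by Hölder's inequality on balls. Since `u` lives on `E`, only the
integral of `|φ|²` over the `ε`-neighbourhood of `E` matters. The bound on the Minkowski content,
applied to the superlevel sets of `|φ|²` in `E`, shows that in the limit `ε → 0` the normalized
integral is at most `A ∫_E |φ|² dν`, up to a factor `2 ^ (n - α)`. Hence `u` is bounded for the norm
of `L²(ν)`, and the Riesz representation theorem yields `u₀`.

The Minkowski bound is assumed only for sets of positive measure; it extends to null sets because
points, having content zero, are `ν`-null.
-/

section Cutoff

variable {V F : Type*} [NormedAddCommGroup V] [NormedSpace ℝ V] [FiniteDimensional ℝ V]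
  [NormedAddCommGroup F] [NormedSpace ℝ F]

theorem exists_norm_iteratedFDeriv_one_sub_bump_le (b : ContDiffBump (0 : V)) (i : ℕ) :
    ∃ C, 0 ≤ C ∧ ∀ y, ‖iteratedFDeriv ℝ i (fun x => 1 - b x) y‖ ≤ C * ‖y‖ := by
  obtain ⟨C, hC⟩ : ∃ C, ∀ y, ‖iteratedFDeriv ℝ i (fun x => 1 - b x) y‖ ≤ C := by
    obtain ⟨B, hB⟩ := (b.hasCompactSupport.iteratedFDeriv (𝕜 := ℝ) i).exists_bound_of_continuous
      (b.contDiff.continuous_iteratedFDeriv le_rfl)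
    refine ⟨1 + B, fun y => ?_⟩
    have hconst : ‖iteratedFDeriv ℝ i (fun _ : V => (1 : ℝ)) y‖ ≤ 1 := by
      rcases i with _ | i <;> simp [iteratedFDeriv_succ_const]
    rw [show (fun x => 1 - b x) = (fun _ : V => (1 : ℝ)) - b from rfl,
      iteratedFDeriv_sub_apply contDiff_const.contDiffAt b.contDiffAt]
    exact (norm_sub_le _ _).trans (add_le_add hconst (hB y))
  have hC0 : 0 ≤ C := (norm_nonneg _).trans (hC 0)
  refine ⟨C / b.rIn, div_nonneg hC0 b.rIn_pos.le, fun y => ?_⟩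
  rcases lt_or_ge ‖y‖ b.rIn with hy | hy
  · have hzero : (fun x => 1 - b x) =ᶠ[𝓝 y] fun _ => (0 : ℝ) := by
      filter_upwards [b.eventuallyEq_one_of_mem_ball (by simpa using hy)] with z hz
      simp [hz]
    rw [(hzero.iteratedFDeriv ℝ i).self_of_nhds, iteratedFDeriv_fun_zero]
    simpa using mul_nonneg (div_nonneg hC0 b.rIn_pos.le) (norm_nonneg y)
  · rw [div_mul_eq_mul_div, mul_div_assoc]
    exact (hC y).trans (le_mul_of_one_le_right hC0 ((one_le_div b.rIn_pos).2 hy))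

theorem hasTemperateGrowth_bump_smul (b : ContDiffBump (0 : V)) {ε : ℝ} (hε : ε ≠ 0) :
    (fun x => b (ε • x)).HasTemperateGrowth :=
  (b.hasCompactSupport.comp_smul hε).hasTemperateGrowth
    (b.contDiff.comp (contDiff_const_smul ε))

theorem smulLeftCLM_bump_apply (b : ContDiffBump (0 : V)) {ε : ℝ} (hε : ε ≠ 0) (g : 𝓢(V, F))
    (x : V) : smulLeftCLM F (fun x => b (ε • x)) g x = b (ε • x) • g x :=
  smulLeftCLM_apply_apply (hasTemperateGrowth_bump_smul b hε) g x

theorem exists_seminorm_smulLeftCLM_bump_sub_le (b : ContDiffBump (0 : V)) (g : 𝓢(V, F))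
    (m l : ℕ) : ∃ K, ∀ ε ∈ Ioc (0 : ℝ) 1,
      SchwartzMap.seminorm ℝ m l (smulLeftCLM F (fun x => b (ε • x)) g - g) ≤ ε * K := by
  choose C hC0 hC using exists_norm_iteratedFDeriv_one_sub_bump_le b
  refine ⟨∑ i ∈ Finset.range (l + 1), (l.choose i : ℝ) * C i *
    SchwartzMap.seminorm ℝ (m + 1) (l - i) g, fun ε ⟨hε, hε1⟩ => ?_⟩
  have hsmooth : ContDiff ℝ (⊤ : ℕ∞) (fun x => 1 - b x) := contDiff_const.sub b.contDiff
  have hderiv : ∀ i x, ‖iteratedFDeriv ℝ i (fun x => 1 - b (ε • x)) x‖ ≤ C i * (ε * ‖x‖) := by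
    intro i x
    have hscale := congrFun (iteratedFDeriv_comp_const_smul (i := i) ε
      (hsmooth.of_le (by exact_mod_cast le_top))) x
    have hbound := hC i (ε • x)
    rw [norm_smul, Real.norm_of_nonneg hε.le] at hbound
    rw [hscale, norm_smul, norm_pow, Real.norm_of_nonneg hε.le]
    exact (mul_le_of_le_one_left (norm_nonneg _) (pow_le_one₀ hε.le hε1)).trans hbound
  have hdiff : ((smulLeftCLM F (fun x => b (ε • x)) g - g : 𝓢(V, F)) : V → F) =
      -(fun x => (1 - b (ε • x)) • g x) := by
    ext x
    simp [smulLeftCLM_bump_apply b hε.ne', sub_smul]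
  refine SchwartzMap.seminorm_le_bound ℝ m l _ (mul_nonneg hε.le (Finset.sum_nonneg fun i _ =>
    mul_nonneg (mul_nonneg (by positivity) (hC0 i)) (apply_nonneg _ _))) fun x => ?_
  rw [hdiff, iteratedFDeriv_neg_apply, norm_neg]
  calc ‖x‖ ^ m * ‖iteratedFDeriv ℝ l (fun x => (1 - b (ε • x)) • g x) x‖
      ≤ ‖x‖ ^ m * ∑ i ∈ Finset.range (l + 1), (l.choose i : ℝ) *
          (C i * (ε * ‖x‖)) * ‖iteratedFDeriv ℝ (l - i) g x‖ := by
        gcongr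
        refine (norm_iteratedFDeriv_smul_le (hsmooth.comp (contDiff_const_smul ε))
          (g.smooth ⊤) x (by exact_mod_cast le_top)).trans ?_
        gcongr
        exact hderiv _ x
    _ = ε * ∑ i ∈ Finset.range (l + 1), (l.choose i : ℝ) * C i *
          (‖x‖ ^ (m + 1) * ‖iteratedFDeriv ℝ (l - i) g x‖) := by
        rw [Finset.mul_sum, Finset.mul_sum]
        exact Finset.sum_congr rfl fun i _ => by ring
    _ ≤ _ := by
        gcongr with i
        · exact mul_nonneg (by positivity) (hC0 i)
        · exact SchwartzMap.le_seminorm ℝ _ _ g x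

theorem tendsto_smulLeftCLM_bump (b : ContDiffBump (0 : V)) (g : 𝓢(V, F)) :
    Tendsto (fun ε : ℝ => smulLeftCLM F (fun x => b (ε • x)) g) (𝓝[>] 0) (𝓝 g) := by
  rw [(schwartz_withSeminorms ℝ V F).tendsto_nhds]
  rintro ⟨m, l⟩ δ hδ
  obtain ⟨K, hK⟩ := exists_seminorm_smulLeftCLM_bump_sub_le b g m l
  have hlim : Tendsto (fun ε : ℝ => ε * K) (𝓝[>] 0) (𝓝 0) := by
    simpa using (tendsto_nhdsWithin_of_tendsto_nhds (tendsto_id (x := 𝓝 (0 : ℝ)))).mul_const K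
  filter_upwards [hlim.eventually (gt_mem_nhds hδ), Ioc_mem_nhdsGT one_pos] with ε hε hε01
  exact (hK ε hε01).trans_lt hε

theorem exists_tendsto_hasCompactSupport (g : 𝓢(V, F)) :
    ∃ G : ℕ → 𝓢(V, F), (∀ k, HasCompactSupport (G k)) ∧ (∀ k, tsupport (G k) ⊆ tsupport g) ∧
      (∀ k x, ‖G k x‖ ≤ ‖g x‖) ∧ Tendsto G atTop (𝓝 g) := by
  let b : ContDiffBump (0 : V) := default
  obtain ⟨ε, -, hεpos, hεlim⟩ := exists_seq_strictAnti_tendsto (0 : ℝ)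
  have hε0 : ∀ k, ε k ≠ 0 := fun k => (hεpos k).ne'
  refine ⟨fun k => smulLeftCLM F (fun x => b (ε k • x)) g, fun k => ?_, fun k => ?_,
    fun k x => ?_, (tendsto_smulLeftCLM_bump b g).comp <| tendsto_nhdsWithin_iff.2
      ⟨hεlim, Eventually.of_forall hεpos⟩⟩
  · exact (b.hasCompactSupport.comp_smul (hε0 k)).of_isClosed_subset (isClosed_tsupport _)
      ((tsupport_smulLeftCLM_subset _ g).trans inter_subset_right)
  · exact (tsupport_smulLeftCLM_subset _ g).trans inter_subset_left
  · rw [smulLeftCLM_bump_apply b (hε0 k), norm_smul, Real.norm_of_nonneg b.nonneg]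
    exact mul_le_of_le_one_left (norm_nonneg _) b.le_one

theorem exists_eqOn_cthickening_support_subset_thickening {E : Set V}
    (hE : IsCompact E) {δ ε : ℝ} (hε : 0 < ε) (hδε : δ < ε) (φ : 𝓢(V, F)) :
    ∃ ψ : 𝓢(V, F), EqOn ψ φ (Metric.cthickening δ E) ∧
      Function.support ψ ⊆ Metric.thickening ε E ∧ ∀ x, ‖ψ x‖ ≤ ‖φ x‖ := by
  obtain ⟨θ, hθ0, hθ1, hθ01⟩ := exists_contMDiffMap_zero_one_of_isClosed (n := (⊤ : ℕ∞))
    (modelWithCornersSelf ℝ V) (Metric.isOpen_thickening (δ := ε) (E := E)).isClosed_compl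
    (Metric.isClosed_cthickening (δ := δ) (E := E)) (disjoint_compl_left_iff_subset.2
      (Metric.cthickening_subset_thickening' hε hδε E))
  have hθ_supp : Function.support θ ⊆ Metric.thickening ε E :=
    Function.support_subset_iff'.2 fun x hx => hθ0 hx
  have hθ_compact : HasCompactSupport θ :=
    .of_support_subset_isCompact (hE.cthickening (r := ε))
      (hθ_supp.trans (Metric.thickening_subset_cthickening _ _))
  have hc : HasCompactSupport (fun x => θ x • φ x) := hθ_compact.smul_right (f' := φ)
  refine ⟨hc.toSchwartzMap (θ.contMDiff.contDiff.smul (φ.smooth _)), fun x hx => ?_,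
    (Function.support_smul_subset_left θ φ).trans hθ_supp, fun x => ?_⟩
  · simp [hθ1 hx]
  · rw [HasCompactSupport.toSchwartzMap_toFun, norm_smul, Real.norm_of_nonneg (hθ01 x).1]
    exact mul_le_of_le_one_left (norm_nonneg _) (hθ01 x).2

end Cutoff

section Support

variable {V F : Type*} [NormedAddCommGroup V] [NormedSpace ℝ V] [FiniteDimensional ℝ V]
  [NormedAddCommGroup F] [NormedSpace ℂ F]

theorem apply_eq_zero_of_hasCompactSupport_of_disjoint_dsupport {u : 𝓢'(V, F)} {g : 𝓢(V, ℂ)}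
    (hgc : HasCompactSupport g) (hg : Disjoint (tsupport g) (Distribution.dsupport u)) :
    u g = 0 := by
  choose U hU hUo hxU using fun x : tsupport g =>
    (Distribution.notMem_dsupport_iff (f := u) (x : V)).1 (disjoint_left.1 hg x.2)
  obtain ⟨ρ, hρ⟩ := SmoothPartitionOfUnity.exists_isSubordinate (modelWithCornersSelf ℝ V)
    (isClosed_tsupport g) U hUo (fun x hx => mem_iUnion.2 ⟨⟨x, hx⟩, hxU ⟨x, hx⟩⟩)
  have hfin := ρ.locallyFinite.finite_nonempty_inter_compact hgc
  have hcs : ∀ i, HasCompactSupport (fun x => ρ i x • g x) := fun i =>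
    hgc.smul_left (f := ρ i)
  have hρ_smooth : ∀ i, ContDiff ℝ (⊤ : ℕ∞) (ρ i) := fun i => (ρ i).contMDiff.contDiff
  have hcd : ∀ i, ContDiff ℝ (⊤ : ℕ∞) (fun x => ρ i x • g x) := fun i =>
    (hρ_smooth i).smul (g.smooth _)
  have hsum : g = ∑ i ∈ hfin.toFinset, (hcs i).toSchwartzMap (hcd i) := by
    ext x
    simp only [sum_apply, HasCompactSupport.toSchwartzMap_toFun, ← Finset.sum_smul]
    by_cases hxg : x ∈ tsupport g
    · rw [← finsum_eq_sum_of_support_subset, ρ.sum_eq_one hxg, one_smul]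
      exact fun i hi => hfin.mem_toFinset.2 ⟨x, hi, hxg⟩
    · simp [image_eq_zero_of_notMem_tsupport hxg]
  rw [hsum, map_sum]
  exact Finset.sum_eq_zero fun i _ => hU i _ ((tsupport_smul_subset_left _ _).trans (hρ i))

theorem apply_eq_zero_of_disjoint_dsupport {u : 𝓢'(V, F)} {g : 𝓢(V, ℂ)}
    (hg : Disjoint (tsupport g) (Distribution.dsupport u)) : u g = 0 := by
  obtain ⟨G, hGc, hGs, -, hG⟩ := exists_tendsto_hasCompactSupport g
  have hu : Tendsto (fun k => u (G k)) atTop (𝓝 (u g)) := (u.continuous.tendsto g).comp hG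
  refine tendsto_nhds_unique hu (tendsto_const_nhds.congr fun k => ?_)
  exact (apply_eq_zero_of_hasCompactSupport_of_disjoint_dsupport (hGc k)
    (hg.mono_left (hGs k))).symm

end Support

section BallGrowth

variable {V : Type*} [NormedAddCommGroup V] [MeasurableSpace V] {μ : Measure V} {β : ℝ} {M : ℝ≥0∞}

/-- The bound `μ (B(0, L)) ≤ M * L ^ β` for all large `L`. It is applied to `μ = |û|² dξ`. -/
def HasBallGrowth (μ : Measure V) (β : ℝ) (M : ℝ≥0∞) : Prop :=
  ∀ᶠ L : ℝ in atTop, μ (Metric.closedBall 0 L) ≤ M * ENNReal.ofReal (L ^ β)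

/-- The sum over the dyadic balls of radius `2 ^ k` of the bound `2 ^ d * 2 ^ (-k * d)` for the
weight `(1 + t) ^ (-d)` on the shell `2 ^ (k - 1) < t ≤ 2 ^ k`, times the growth `2 ^ (k * β)`. -/
noncomputable def dyadicSum (d : ℕ) (β : ℝ) : ℝ≥0∞ :=
  ∑' k : ℕ, ENNReal.ofReal (2 ^ d * ((2 : ℝ) ^ k) ^ (β - d))

theorem dyadicSum_lt_top {d : ℕ} (h : β < d) : dyadicSum d β < ∞ := by
  have hratio : (2 : ℝ) ^ (β - d) < 1 :=
    Real.rpow_lt_one_of_one_lt_of_neg one_lt_two (sub_neg.2 h)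
  refine Summable.tsum_ofReal_lt_top (.mul_left _ ?_)
  simpa only [← Real.rpow_pow_comm zero_le_two] using
    summable_geometric_of_lt_one (by positivity) hratio

theorem inv_one_add_pow_le_tsum_indicator (d : ℕ) {t : ℝ} (ht : 0 ≤ t) :
    ENNReal.ofReal (((1 + t) ^ d)⁻¹) ≤ ∑' k : ℕ,
      (Iic ((2 : ℝ) ^ k)).indicator
        (fun _ => ENNReal.ofReal (2 ^ d * (((2 : ℝ) ^ k) ^ d)⁻¹)) t := by
  classical
  have hex : ∃ k : ℕ, t ≤ (2 : ℝ) ^ k :=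
    (pow_unbounded_of_one_lt t one_lt_two).imp fun _ h => h.le
  refine le_trans ?_ (ENNReal.le_tsum (Nat.find hex))
  rw [indicator_of_mem (show t ∈ Iic ((2 : ℝ) ^ Nat.find hex) from Nat.find_spec hex)]
  refine ENNReal.ofReal_le_ofReal ?_
  rw [← div_eq_mul_inv, ← div_pow, ← inv_pow]
  gcongr
  rw [inv_le_comm₀ (by positivity) (by positivity), inv_div]
  rcases hk : Nat.find hex with _ | k
  · linarith
  · have hlt : (2 : ℝ) ^ k < t := not_le.1 (Nat.find_min hex (by lia))
    rw [pow_succ]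
    linarith

theorem HasBallGrowth.eventually_lintegral_inv_one_add_pow_le [OpensMeasurableSpace V]
    (h : HasBallGrowth μ β M) (d : ℕ) :
    ∀ᶠ ε : ℝ in 𝓝[>] 0, ∫⁻ ξ, ENNReal.ofReal (((1 + ε * ‖ξ‖) ^ d)⁻¹) ∂μ ≤
      dyadicSum d β * (M * ENNReal.ofReal (ε⁻¹ ^ β)) := by
  obtain ⟨L₀, hL₀⟩ := eventually_atTop.1 h
  filter_upwards [self_mem_nhdsWithin, tendsto_inv_nhdsGT_zero.eventually_ge_atTop L₀]
    with ε (hε : 0 < ε) hεL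
  have hball (k : ℕ) (ξ : V) :
      ε * ‖ξ‖ ∈ Iic ((2 : ℝ) ^ k) ↔ ξ ∈ Metric.closedBall 0 (2 ^ k * ε⁻¹) := by
    rw [mem_Iic, mem_closedBall_zero_iff, ← div_eq_mul_inv, le_div_iff₀ hε, mul_comm]
  calc ∫⁻ ξ, ENNReal.ofReal (((1 + ε * ‖ξ‖) ^ d)⁻¹) ∂μ
      ≤ ∫⁻ ξ, ∑' k : ℕ, (Metric.closedBall (0 : V) (2 ^ k * ε⁻¹)).indicator
          (fun _ => ENNReal.ofReal (2 ^ d * (((2 : ℝ) ^ k) ^ d)⁻¹)) ξ ∂μ := by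
        refine lintegral_mono fun ξ => ?_
        classical
        simpa only [indicator_apply, hball] using
          inv_one_add_pow_le_tsum_indicator d (t := ε * ‖ξ‖) (by positivity)
    _ = ∑' k : ℕ, ENNReal.ofReal (2 ^ d * (((2 : ℝ) ^ k) ^ d)⁻¹) *
          μ (Metric.closedBall (0 : V) (2 ^ k * ε⁻¹)) := by
        have hmeas (k : ℕ) : MeasurableSet (Metric.closedBall (0 : V) (2 ^ k * ε⁻¹)) :=
          Metric.isClosed_closedBall.measurableSet
        rw [lintegral_tsum fun k => (measurable_const.indicator (hmeas k)).aemeasurable]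
        simp only [lintegral_indicator_const (hmeas _)]
    _ ≤ ∑' k : ℕ, ENNReal.ofReal (2 ^ d * ((2 : ℝ) ^ k) ^ (β - d)) *
          (M * ENNReal.ofReal (ε⁻¹ ^ β)) := by
        refine ENNReal.tsum_le_tsum fun k => ?_
        have hk : L₀ ≤ 2 ^ k * ε⁻¹ := hεL.trans
          (le_mul_of_one_le_left (by positivity) (one_le_pow₀ one_le_two))
        grw [hL₀ _ hk]
        have hsplit : (2 : ℝ) ^ d * ((2 : ℝ) ^ k) ^ (β - d) =
            2 ^ d * (((2 : ℝ) ^ k) ^ d)⁻¹ * ((2 : ℝ) ^ k) ^ β := by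
          rw [Real.rpow_sub_natCast (by positivity)]
          ring
        rw [hsplit, Real.mul_rpow (by positivity) (by positivity),
          ENNReal.ofReal_mul (q := ε⁻¹ ^ β) (by positivity),
          ENNReal.ofReal_mul (q := ((2 : ℝ) ^ k) ^ β) (by positivity)]
        apply le_of_eq
        ring
    _ = dyadicSum d β * (M * ENNReal.ofReal (ε⁻¹ ^ β)) := ENNReal.tsum_mul_right

theorem HasBallGrowth.hasTemperateGrowth [OpensMeasurableSpace V]
    (h : HasBallGrowth μ β M) (hM : M ≠ ∞) : μ.HasTemperateGrowth := by
  obtain ⟨d, hd⟩ := exists_nat_gt β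
  obtain ⟨ε, hε, ⟨hε0, hε1⟩⟩ :=
    ((h.eventually_lintegral_inv_one_add_pow_le d).and (Ioc_mem_nhdsGT one_pos)).exists
  have hmeas : Measurable fun ξ : V => (1 + ‖ξ‖) ^ (-(d : ℝ)) := by fun_prop
  refine ⟨d, hmeas.aestronglyMeasurable, lt_of_le_of_lt (lintegral_mono fun ξ => ?_)
    (hε.trans_lt <| ENNReal.mul_lt_top (dyadicSum_lt_top hd) <|
      ENNReal.mul_lt_top hM.lt_top ENNReal.ofReal_lt_top)⟩
  beta_reduce
  rw [Real.rpow_neg (by positivity), Real.rpow_natCast, Real.enorm_of_nonneg (by positivity)]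
  gcongr
  exact mul_le_of_le_one_left (norm_nonneg ξ) hε1

end BallGrowth

theorem enorm_sq_eq_lintegral {X H : Type*} [MeasurableSpace X] {μ : Measure X}
    [NormedAddCommGroup H] (g : Lp H 2 μ) : ‖g‖ₑ ^ 2 = ∫⁻ x, ‖g x‖ₑ ^ 2 ∂μ := by
  simpa [Lp.enorm_def] using eLpNorm_nnreal_pow_eq_lintegral (μ := μ) (f := g) (p := 2) two_ne_zero

section TemperateGrowth

variable {V : Type*} [NormedAddCommGroup V] [NormedSpace ℝ V]

theorem exists_norm_le_inv_one_add_pow {F : Type*} [NormedAddCommGroup F] [NormedSpace ℝ F]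
    (φ : 𝓢(V, F)) (d : ℕ) : ∃ C : ℝ≥0, ∀ ξ, ‖φ ξ‖ ≤ C * ((1 + ‖ξ‖) ^ d)⁻¹ := by
  let C := 2 ^ d * ((Finset.Iic (d, 0)).sup fun m => SchwartzMap.seminorm ℝ m.1 m.2) φ
  have hC (ξ : V) : (1 + ‖ξ‖) ^ d * ‖φ ξ‖ ≤ C := by
    simpa using one_add_le_sup_seminorm_apply (𝕜 := ℝ) (m := (d, 0)) le_rfl le_rfl φ ξ
  refine ⟨C.toNNReal, fun ξ => ?_⟩
  rw [← div_eq_mul_inv, le_div_iff₀' (by positivity)]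
  exact (hC ξ).trans (Real.le_coe_toNNReal C)

variable [MeasurableSpace V] [BorelSpace V]

theorem exists_lintegral_enorm_sq_comp_smul_le {F : Type*} [NormedAddCommGroup F]
    [NormedSpace ℝ F] (m : 𝓢(V, F)) (β : ℝ) :
    ∃ C : ℝ≥0, ∀ (μ : Measure V) (M : ℝ≥0∞), HasBallGrowth μ β M →
      ∀ᶠ ε : ℝ in 𝓝[>] 0,
        ∫⁻ ξ, ‖m (ε • ξ)‖ₑ ^ 2 ∂μ ≤ C * (M * ENNReal.ofReal (ε⁻¹ ^ β)) := by
  obtain ⟨d, hd⟩ := exists_nat_gt β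
  obtain ⟨C, hC⟩ := exists_norm_le_inv_one_add_pow m d
  obtain ⟨D, hD, -⟩ := ENNReal.lt_iff_exists_coe.1 (dyadicSum_lt_top hd)
  refine ⟨C ^ 2 * D, fun μ M h => ?_⟩
  filter_upwards [h.eventually_lintegral_inv_one_add_pow_le d, self_mem_nhdsWithin]
    with ε hε (hε0 : 0 < ε)
  have hm (ξ : V) : ‖m (ε • ξ)‖ₑ ^ 2 ≤
      (C : ℝ≥0∞) ^ 2 * ENNReal.ofReal (((1 + ε * ‖ξ‖) ^ d)⁻¹) := by
    have hweight : ((1 + ε * ‖ξ‖) ^ d)⁻¹ ≤ 1 :=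
      inv_le_one_of_one_le₀ (one_le_pow₀ (le_add_of_nonneg_right (by positivity)))
    have hnorm : ‖m (ε • ξ)‖ₑ ≤ C * ENNReal.ofReal (((1 + ε * ‖ξ‖) ^ d)⁻¹) := by
      rw [← ofReal_norm, ← ENNReal.ofReal_coe_nnreal, ← ENNReal.ofReal_mul C.coe_nonneg]
      refine ENNReal.ofReal_le_ofReal ?_
      simpa only [norm_smul, Real.norm_of_nonneg hε0.le] using hC (ε • ξ)
    calc ‖m (ε • ξ)‖ₑ ^ 2 ≤ (C * ENNReal.ofReal (((1 + ε * ‖ξ‖) ^ d)⁻¹)) ^ 2 := by gcongr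
      _ ≤ _ := by
        rw [mul_pow]
        gcongr
        exact pow_le_of_le_one (by positivity) (by simpa using hweight) two_ne_zero
  grw [lintegral_mono hm, lintegral_const_mul' _ _ (by finiteness), hε, hD]
  push_cast
  rw [mul_assoc]

variable [SecondCountableTopology V]

theorem integrable_schwartz_mul {μ : Measure V} [μ.HasTemperateGrowth] {f : V → ℂ}
    (hf : AEStronglyMeasurable f μ)
    (hsq : (μ.withDensity fun ξ => ‖f ξ‖ₑ ^ 2).HasTemperateGrowth) (φ : 𝓢(V, ℂ)) :
    Integrable (fun ξ => φ ξ * f ξ) μ := by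
  refine ⟨φ.integrable.aestronglyMeasurable.mul hf, ?_⟩
  have hle (ξ : V) : ‖φ ξ * f ξ‖ₑ ≤ ‖φ ξ‖ₑ + ‖f ξ‖ₑ ^ 2 * ‖φ ξ‖ₑ := by
    have hsq_ge : ‖f ξ‖ₑ ≤ 1 + ‖f ξ‖ₑ ^ 2 := by
      rcases le_total ‖f ξ‖ₑ 1 with h | h
      · exact h.trans le_self_add
      · exact (le_self_pow₀ h two_ne_zero).trans le_add_self
    calc ‖φ ξ * f ξ‖ₑ ≤ ‖φ ξ‖ₑ * (1 + ‖f ξ‖ₑ ^ 2) := by rw [enorm_mul]; gcongr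
      _ = ‖φ ξ‖ₑ + ‖f ξ‖ₑ ^ 2 * ‖φ ξ‖ₑ := by ring
  refine (lintegral_mono hle).trans_lt ?_
  have hφ : Integrable φ μ := φ.integrable
  have hφ_sq : Integrable φ (μ.withDensity fun ξ => ‖f ξ‖ₑ ^ 2) := φ.integrable
  rw [lintegral_add_left' hφ.aestronglyMeasurable.enorm]
  refine ENNReal.add_lt_top.2 ⟨hφ.2, ?_⟩
  have hdens := lintegral_withDensity_eq_lintegral_mul₀ (hf.enorm.pow_const 2)
    hφ.aestronglyMeasurable.enorm
  exact hdens.symm.trans_lt hφ_sq.2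

theorem enorm_sq_toLp {H : Type*} [NormedAddCommGroup H] [NormedSpace ℝ H] {μ : Measure V}
    [μ.HasTemperateGrowth] (φ : 𝓢(V, H)) :
    ‖φ.toLp 2 μ‖ₑ ^ 2 = ∫⁻ x, ‖φ x‖ₑ ^ 2 ∂μ := by
  rw [enorm_sq_eq_lintegral]
  refine lintegral_congr_ae ?_
  filter_upwards [φ.coeFn_toLp 2 μ] with x hx
  rw [hx]

end TemperateGrowth

namespace IsFunctionDistribution

variable {n : ℕ} {v : 𝓢'(EuclideanSpace ℝ (Fin n), ℂ)} {f : EuclideanSpace ℝ (Fin n) → ℂ}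

theorem apply_eq_integral (hv : IsFunctionDistribution v f)
    (hint : ∀ φ : 𝓢(EuclideanSpace ℝ (Fin n), ℂ), Integrable (fun ξ => φ ξ * f ξ))
    (φ : 𝓢(EuclideanSpace ℝ (Fin n), ℂ)) : v φ = ∫ ξ, φ ξ * f ξ := by
  obtain ⟨G, hGc, -, hGφ, hG⟩ := exists_tendsto_hasCompactSupport φ
  have hlim : Tendsto (fun k => v (G k)) atTop (𝓝 (v φ)) := (v.continuous.tendsto φ).comp hG
  have hptwise (ξ) : Tendsto (fun k => G k ξ) atTop (𝓝 (φ ξ)) :=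
    ((TemperedDistribution.delta ξ).continuous.tendsto φ).comp hG
  refine tendsto_nhds_unique hlim ?_
  simp only [hv.2 _ (hGc _)]
  refine tendsto_integral_of_dominated_convergence (fun ξ => ‖φ ξ * f ξ‖)
    (fun k => (hint (G k)).aestronglyMeasurable) (hint φ).norm (fun k => ?_) ?_
  · filter_upwards with ξ
    rw [norm_mul, norm_mul]
    gcongr
    exact hGφ k ξ
  · filter_upwards with ξ
    exact (hptwise ξ).mul_const _

theorem ae_eq {g : EuclideanSpace ℝ (Fin n) → ℂ} (hf : IsFunctionDistribution v f)
    (hg : IsFunctionDistribution v g) : f =ᵐ[volume] g := by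
  refine ae_eq_of_integral_contDiff_smul_eq hf.1 hg.1 fun w hw hwc => ?_
  have hc : HasCompactSupport (fun x => (w x : ℂ)) := hwc.comp_left Complex.ofReal_zero
  let φ := hc.toSchwartzMap (Complex.ofRealCLM.contDiff.comp hw)
  exact (hf.2 φ hc).symm.trans (hg.2 φ hc)

theorem lpMassOnBall_eq (hf : IsFunctionDistribution v f) (p L : ℝ) :
    lpMassOnBall v p L = ∫⁻ ξ in Metric.closedBall 0 L, ‖f ξ‖ₑ ^ p := by
  refine le_antisymm (iInf₂_le f hf) (le_iInf₂ fun g hg => le_of_eq ?_)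
  refine lintegral_congr_ae (ae_restrict_of_ae ?_)
  filter_upwards [hf.ae_eq hg] with ξ hξ
  rw [hξ]

end IsFunctionDistribution

section TemperedFunction

variable {V : Type*} [NormedAddCommGroup V] [InnerProductSpace ℝ V] [FiniteDimensional ℝ V]
  [MeasurableSpace V] [BorelSpace V]

/-- The tempered distribution `v` is integration against `f` on every Schwartz function, whereas
`IsFunctionDistribution` tests only against those of compact support. -/
structure IsTemperedFunction (v : 𝓢'(V, ℂ)) (f : V → ℂ) : Prop where
  aestronglyMeasurable : AEStronglyMeasurable f volume
  integrable : ∀ φ : 𝓢(V, ℂ), Integrable (fun ξ => φ ξ * f ξ)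
  apply_eq_integral : ∀ φ : 𝓢(V, ℂ), v φ = ∫ ξ, φ ξ * f ξ

theorem IsFunctionDistribution.isTemperedFunction {n : ℕ}
    {v : 𝓢'(EuclideanSpace ℝ (Fin n), ℂ)} {f : EuclideanSpace ℝ (Fin n) → ℂ}
    (hv : IsFunctionDistribution v f) {β : ℝ} {M : ℝ≥0∞} (hM : M ≠ ∞)
    (h : HasBallGrowth (volume.withDensity fun ξ => ‖f ξ‖ₑ ^ 2) β M) :
    IsTemperedFunction v f := by
  have hf := hv.1.aestronglyMeasurable
  have hint := integrable_schwartz_mul hf (h.hasTemperateGrowth hM)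
  exact ⟨hf, hint, hv.apply_eq_integral hint⟩

local infixl:67 " ⋆ₛ " => SchwartzMap.convolution (ContinuousLinearMap.mul ℂ ℂ)

theorem fourierInv_convolution_apply (χ φ : 𝓢(V, ℂ)) (ξ : V) :
    𝓕⁻ (χ ⋆ₛ φ) ξ = 𝓕⁻ χ ξ * 𝓕⁻ φ ξ := by
  have hneg (ψ : 𝓢(V, ℂ)) : 𝓕⁻ ψ ξ = 𝓕 ψ (-ξ) := by
    rw [fourierInv_coe, Real.fourierInv_eq_fourier_neg, fourier_coe]
  rw [hneg, hneg, hneg, fourier_convolution, pairing_apply_apply, ContinuousLinearMap.mul_apply']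

theorem lintegral_enorm_sq_fourierInv {H : Type*} [NormedAddCommGroup H] [InnerProductSpace ℂ H]
    [CompleteSpace H] (φ : 𝓢(V, H)) : ∫⁻ ξ, ‖𝓕⁻ φ ξ‖ₑ ^ 2 = ∫⁻ x, ‖φ x‖ₑ ^ 2 := by
  rw [← enorm_sq_toLp, ← enorm_sq_toLp, ← ofReal_norm, ← ofReal_norm,
    ← norm_fourier_toL2_eq (𝓕⁻ φ), fourier_fourierInv_eq]

theorem sq_lintegral_mul_le {X : Type*} [MeasurableSpace X] {μ : Measure X} {f g : X → ℝ≥0∞}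
    (hf : AEMeasurable f μ) (hg : AEMeasurable g μ) :
    (∫⁻ x, f x * g x ∂μ) ^ 2 ≤ (∫⁻ x, f x ^ 2 ∂μ) * ∫⁻ x, g x ^ 2 ∂μ := by
  have h := ENNReal.lintegral_mul_le_Lp_mul_Lq μ Real.HolderConjugate.two_two hf hg
  simp only [Pi.mul_apply, ENNReal.rpow_two, one_div] at h
  calc (∫⁻ x, f x * g x ∂μ) ^ 2
      ≤ ((∫⁻ x, f x ^ 2 ∂μ) ^ (2⁻¹ : ℝ) * (∫⁻ x, g x ^ 2 ∂μ) ^ (2⁻¹ : ℝ)) ^ 2 := by gcongr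
    _ = (∫⁻ x, f x ^ 2 ∂μ) * ∫⁻ x, g x ^ 2 ∂μ := by
        rw [mul_pow, ← ENNReal.rpow_two, ← ENNReal.rpow_two, ENNReal.rpow_inv_rpow two_ne_zero,
          ENNReal.rpow_inv_rpow two_ne_zero]

namespace IsTemperedFunction

variable {u : 𝓢'(V, ℂ)} {f : V → ℂ}

theorem apply_eq_integral_fourierInv (hf : IsTemperedFunction (𝓕 u) f) (φ : 𝓢(V, ℂ)) :
    u φ = ∫ ξ, 𝓕⁻ φ ξ * f ξ := by
  rw [← hf.apply_eq_integral, TemperedDistribution.fourier_apply, fourier_fourierInv_eq]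

theorem enorm_apply_convolution_sq_le (hf : IsTemperedFunction (𝓕 u) f) (χ φ : 𝓢(V, ℂ)) :
    ‖u (χ ⋆ₛ φ)‖ₑ ^ 2 ≤
      (∫⁻ ξ, ‖𝓕⁻ χ ξ‖ₑ ^ 2 ∂(volume.withDensity fun ξ => ‖f ξ‖ₑ ^ 2)) * ∫⁻ x, ‖φ x‖ₑ ^ 2 := by
  have hfm := hf.aestronglyMeasurable.enorm
  have hm (ψ : 𝓢(V, ℂ)) : AEMeasurable (fun ξ => ‖ψ ξ‖ₑ) volume := by fun_prop
  calc ‖u (χ ⋆ₛ φ)‖ₑ ^ 2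
      ≤ (∫⁻ ξ, (‖f ξ‖ₑ * ‖𝓕⁻ χ ξ‖ₑ) * ‖𝓕⁻ φ ξ‖ₑ) ^ 2 := by
        rw [hf.apply_eq_integral_fourierInv]
        gcongr
        refine (enorm_integral_le_lintegral_enorm _).trans_eq (lintegral_congr fun ξ => ?_)
        rw [fourierInv_convolution_apply, enorm_mul, enorm_mul]
        ring
    _ ≤ (∫⁻ ξ, (‖f ξ‖ₑ * ‖𝓕⁻ χ ξ‖ₑ) ^ 2) * ∫⁻ ξ, ‖𝓕⁻ φ ξ‖ₑ ^ 2 :=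
        sq_lintegral_mul_le (hfm.mul (hm _)) (hm _)
    _ = _ := by
        rw [lintegral_enorm_sq_fourierInv,
          lintegral_withDensity_eq_lintegral_mul₀ (hfm.pow_const 2) ((hm _).pow_const 2)]
        simp only [Pi.mul_apply, mul_pow]

end IsTemperedFunction

theorem tsupport_convolution_subset_compl_thickening {E : Set V} {δ : ℝ} {χ φ : 𝓢(V, ℂ)}
    (hχ : Function.support χ ⊆ Metric.closedBall 0 δ)
    (hφ : EqOn φ 0 (Metric.cthickening (2 * δ) E)) :
    tsupport (χ ⋆ₛ φ) ⊆ (Metric.thickening δ E)ᶜ := by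
  refine closure_minimal (fun x hx hxE => ?_) Metric.isOpen_thickening.isClosed_compl
  rw [Function.mem_support, convolution_apply] at hx
  obtain ⟨y, hy, z, hz, rfl⟩ := support_convolution_subset _ hx
  obtain ⟨e, heE, he⟩ := Metric.mem_thickening_iff.1 hxE
  refine hz (hφ (Metric.mem_cthickening_of_dist_le z e _ E heE ?_))
  have hyz : dist z (y + z) ≤ δ := by simpa using hχ hy
  linarith [dist_triangle z (y + z) e]

theorem apply_convolution_eq_of_eqOn_cthickening {u : 𝓢'(V, ℂ)} {E : Set V}
    (hu : Distribution.dsupport u ⊆ E) {δ : ℝ} (hδ : 0 < δ) {χ φ ψ : 𝓢(V, ℂ)}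
    (hχ : Function.support χ ⊆ Metric.closedBall 0 δ)
    (h : EqOn φ ψ (Metric.cthickening (2 * δ) E)) : u (χ ⋆ₛ φ) = u (χ ⋆ₛ ψ) := by
  have hsub : EqOn (φ - ψ : 𝓢(V, ℂ)) 0 (Metric.cthickening (2 * δ) E) := fun x hx => by
    simp [h hx]
  rw [← sub_eq_zero, ← map_sub, ← map_sub]
  refine apply_eq_zero_of_disjoint_dsupport (Disjoint.mono
    (tsupport_convolution_subset_compl_thickening hχ hsub) hu ?_)
  exact disjoint_compl_left_iff_subset.2 (Metric.self_subset_thickening hδ E)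

theorem IsTemperedFunction.enorm_apply_convolution_sq_le_thickening {u : 𝓢'(V, ℂ)} {f : V → ℂ}
    (hf : IsTemperedFunction (𝓕 u) f) {E : Set V} (hE : IsCompact E)
    (hu : Distribution.dsupport u ⊆ E) {ε : ℝ} (hε : 0 < ε) {χ : 𝓢(V, ℂ)}
    (hχ : Function.support χ ⊆ Metric.closedBall 0 (ε / 3)) (φ : 𝓢(V, ℂ)) :
    ‖u (χ ⋆ₛ φ)‖ₑ ^ 2 ≤
      (∫⁻ ξ, ‖𝓕⁻ χ ξ‖ₑ ^ 2 ∂(volume.withDensity fun ξ => ‖f ξ‖ₑ ^ 2)) *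
        ∫⁻ x in Metric.thickening ε E, ‖φ x‖ₑ ^ 2 := by
  obtain ⟨ψ, hψφ, hψ_supp, hψ_le⟩ :=
    exists_eqOn_cthickening_support_subset_thickening hE hε
      (show 2 * (ε / 3) < ε by linarith) φ
  rw [← apply_convolution_eq_of_eqOn_cthickening hu (by positivity) hχ hψφ]
  grw [hf.enorm_apply_convolution_sq_le χ ψ]
  have hsupp : Function.support (fun x => ‖ψ x‖ₑ ^ 2) ⊆ Metric.thickening ε E := by
    intro x hx
    exact hψ_supp (by simpa using hx)
  rw [← setLIntegral_eq_of_support_subset hsupp]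
  gcongr with x
  exact enorm_le_iff_norm_le.2 (hψ_le x)

/-- The family `χ ε` concentrates at the origin as `ε → 0`, and its inverse Fourier transforms are
the dilates of a single Schwartz function `m`. The radius `ε / 3` is such that `u (χ ε * φ)`, for
`u` supported in `E`, only depends on `φ` in the `ε`-neighbourhood of `E`. -/
structure IsMollifier (χ : ℝ → 𝓢(V, ℂ)) (m : 𝓢(V, ℂ)) : Prop where
  support_subset : ∀ ε, 0 < ε → Function.support (χ ε) ⊆ Metric.closedBall 0 (ε / 3)
  fourierInv_apply : ∀ ε, 0 < ε → ∀ ξ, 𝓕⁻ (χ ε) ξ = m (ε • ξ)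
  map_zero : m 0 = 1

theorem fourierInv_comp_inv_smul {F : Type*} [NormedAddCommGroup F] [NormedSpace ℂ F] {ε : ℝ}
    (hε : 0 < ε) (g : V → F) (ξ : V) :
    𝓕⁻ (fun x => g (ε⁻¹ • x)) ξ = ε ^ Module.finrank ℝ V • 𝓕⁻ g (ε • ξ) := by
  rw [Real.fourierInv_eq, Real.fourierInv_eq, ← Measure.integral_comp_inv_smul_of_nonneg _ _ hε.le]
  refine integral_congr_ae (Eventually.of_forall fun x => ?_)
  have hinner : inner ℝ (ε⁻¹ • x) (ε • ξ) = inner ℝ x ξ := by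
    rw [real_inner_smul_left, real_inner_smul_right, inv_mul_cancel_left₀ hε.ne']
  simp only [hinner]

variable (V) in
theorem exists_isMollifier : ∃ (χ : ℝ → 𝓢(V, ℂ)) (m : 𝓢(V, ℂ)), IsMollifier χ m := by
  let b : ContDiffBump (0 : V) := ⟨1 / 6, 1 / 3, by norm_num, by norm_num⟩
  let g : V → ℂ := fun x => (b.normed volume x : ℂ)
  have hg_compact : HasCompactSupport g :=
    b.hasCompactSupport_normed.comp_left Complex.ofReal_zero
  have hg_smooth : ContDiff ℝ (⊤ : ℕ∞) g := Complex.ofRealCLM.contDiff.comp b.contDiff_normed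
  have hg_supp : Function.support g ⊆ Metric.closedBall 0 (1 / 3) := by
    refine (Function.support_comp_subset Complex.ofReal_zero _).trans ?_
    exact b.support_normed_eq.trans_subset Metric.ball_subset_closedBall
  have hdilate (ε : ℝ) (hε : 0 < ε) : ∃ ψ : 𝓢(V, ℂ), ⇑ψ = fun x => g (ε⁻¹ • x) :=
    ⟨(hg_compact.comp_smul (inv_ne_zero hε.ne')).toSchwartzMap
      (hg_smooth.comp (contDiff_const_smul ε⁻¹)), rfl⟩
  choose! ψ hψ using hdilate
  refine ⟨fun ε => (ε ^ Module.finrank ℝ V)⁻¹ • ψ ε, 𝓕⁻ (hg_compact.toSchwartzMap hg_smooth),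
    fun ε hε x hx => ?_, fun ε hε ξ => ?_, ?_⟩
  · have hxψ : x ∈ Function.support (ψ ε) := Function.support_const_smul_subset _ _ hx
    rw [hψ ε hε] at hxψ
    have hball := hg_supp hxψ
    rw [mem_closedBall_zero_iff, norm_smul, Real.norm_of_nonneg (by positivity),
      inv_mul_le_iff₀ hε] at hball
    simpa [div_eq_mul_inv] using hball
  · rw [FourierTransform.fourierInv_smul, smul_apply, fourierInv_coe, fourierInv_coe,
      hψ ε hε, fourierInv_comp_inv_smul hε, inv_smul_smul₀ (by positivity)]
    rfl
  · rw [fourierInv_coe, Real.fourierInv_eq]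
    simp only [inner_zero_right, AddChar.map_zero_eq_one, one_smul,
      HasCompactSupport.toSchwartzMap_toFun, g]
    rw [integral_complex_ofReal, b.integral_normed, Complex.ofReal_one]

theorem IsMollifier.tendsto_apply_convolution {u : 𝓢'(V, ℂ)} {f : V → ℂ} {χ : ℝ → 𝓢(V, ℂ)}
    {m : 𝓢(V, ℂ)} (hχ : IsMollifier χ m) (hf : IsTemperedFunction (𝓕 u) f) (φ : 𝓢(V, ℂ)) :
    Tendsto (fun ε => u (χ ε ⋆ₛ φ)) (𝓝[>] 0) (𝓝 (u φ)) := by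
  obtain ⟨C, hC⟩ := exists_norm_le_inv_one_add_pow m 0
  have hcongr : (fun ε => ∫ ξ, m (ε • ξ) * (𝓕⁻ φ ξ * f ξ)) =ᶠ[𝓝[>] 0] fun ε => u (χ ε ⋆ₛ φ) := by
    filter_upwards [self_mem_nhdsWithin] with ε (hε : 0 < ε)
    simp only [hf.apply_eq_integral_fourierInv, fourierInv_convolution_apply,
      hχ.fourierInv_apply ε hε, mul_assoc]
  refine Tendsto.congr' hcongr ?_
  rw [hf.apply_eq_integral_fourierInv φ]
  refine tendsto_integral_filter_of_dominated_convergence (fun ξ => C * ‖𝓕⁻ φ ξ * f ξ‖)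
    (Eventually.of_forall fun ε => ?_) (Eventually.of_forall fun ε => ae_of_all _ fun ξ => ?_)
    ((hf.integrable _).norm.const_mul C) (ae_of_all _ fun ξ => ?_)
  · exact Continuous.aestronglyMeasurable (by fun_prop) |>.mul
      (hf.integrable _).aestronglyMeasurable
  · rw [norm_mul]
    gcongr
    simpa using hC (ε • ξ)
  · have hm : Continuous fun ε : ℝ => m (ε • ξ) * (𝓕⁻ φ ξ * f ξ) := by fun_prop
    simpa [hχ.map_zero] using (hm.tendsto 0).mono_left nhdsWithin_le_nhds

variable (V) in
theorem exists_enorm_apply_sq_le_limsup (β : ℝ) :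
    ∃ C : ℝ≥0, ∀ (u : 𝓢'(V, ℂ)) (f : V → ℂ), IsTemperedFunction (𝓕 u) f → ∀ M : ℝ≥0∞, M ≠ ∞ →
      HasBallGrowth (volume.withDensity fun ξ => ‖f ξ‖ₑ ^ 2) β M →
      ∀ E : Set V, IsCompact E → Distribution.dsupport u ⊆ E → ∀ φ : 𝓢(V, ℂ),
        ‖u φ‖ₑ ^ 2 ≤ C * M * limsup (fun ε : ℝ => ENNReal.ofReal (ε⁻¹ ^ β) *
          ∫⁻ x in Metric.thickening ε E, ‖φ x‖ₑ ^ 2) (𝓝[>] 0) := by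
  obtain ⟨χ, m, hχ⟩ := exists_isMollifier V
  obtain ⟨C, hC⟩ := exists_lintegral_enorm_sq_comp_smul_le m β
  refine ⟨C, fun u f hf M hM hgrowth E hE hu φ => ?_⟩
  have hlim : Tendsto (fun ε => ‖u (χ ε ⋆ₛ φ)‖ₑ ^ 2) (𝓝[>] 0) (𝓝 (‖u φ‖ₑ ^ 2)) :=
    ((ENNReal.continuous_pow 2).tendsto _).comp (hχ.tendsto_apply_convolution hf φ).enorm
  rw [← hlim.limsup_eq, ← ENNReal.limsup_const_mul_of_ne_top (by finiteness)]
  refine limsup_le_limsup ?_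
  filter_upwards [hC _ M hgrowth, self_mem_nhdsWithin] with ε hCε (hε : 0 < ε)
  grw [hf.enorm_apply_convolution_sq_le_thickening hE hu hε (hχ.support_subset ε hε) φ]
  simp only [hχ.fourierInv_apply ε hε]
  grw [hCε]
  apply le_of_eq
  ring

end TemperedFunction

section Thickening

theorem ennreal_limsup_add_le {ι : Type*} {l : Filter ι} (u v : ι → ℝ≥0∞) :
    limsup (fun i => u i + v i) l ≤ limsup u l + limsup v l := by
  refine ENNReal.le_of_forall_pos_le_add fun δ hδ hfin => ?_
  obtain ⟨hu, hv⟩ := ENNReal.add_lt_top.1 hfin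
  have hδ2 : (δ / 2 : ℝ≥0∞) ≠ 0 := by simpa using hδ.ne'
  refine limsup_le_of_le (h := ?_)
  filter_upwards [eventually_lt_of_limsup_lt (ENNReal.lt_add_right hu.ne hδ2),
    eventually_lt_of_limsup_lt (ENNReal.lt_add_right hv.ne hδ2)] with i hui hvi
  calc u i + v i ≤ (limsup u l + δ / 2) + (limsup v l + δ / 2) := by gcongr
    _ = limsup u l + limsup v l + δ := by rw [add_add_add_comm, ENNReal.add_halves]

theorem ennreal_limsup_sum_le {ι κ : Type*} {l : Filter ι} (s : Finset κ) (u : κ → ι → ℝ≥0∞) :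
    limsup (fun i => ∑ k ∈ s, u k i) l ≤ ∑ k ∈ s, limsup (u k) l := by
  classical
  induction s using Finset.induction_on with
  | empty => simpa using (limsup_const_bot (f := l) (α := ℝ≥0∞)).le
  | insert a s ha ih =>
    simp only [Finset.sum_insert ha]
    grw [ennreal_limsup_add_le, ih]

theorem sum_indicator_Ici_eq_min_mul {η : ℝ≥0} (hη : 0 < η) (N : ℕ) (t : ℝ≥0) :
    ∑ k ∈ Finset.range N, (Ici ((k + 1) * η)).indicator (fun _ => η) t =
      (min N ⌊t / η⌋₊ : ℕ) * η := by
  have hmem (k : ℕ) : t ∈ Ici ((k + 1) * η) ↔ k + 1 ≤ ⌊t / η⌋₊ := by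
    rw [mem_Ici, Nat.le_floor_iff zero_le, le_div_iff₀ hη, Nat.cast_succ]
  induction N with
  | zero => simp
  | succ N ih =>
    rw [Finset.sum_range_succ, ih]
    by_cases h : N + 1 ≤ ⌊t / η⌋₊
    · rw [indicator_of_mem ((hmem N).2 h), min_eq_left h, min_eq_left (by lia), Nat.cast_succ,
        add_one_mul]
    · rw [indicator_of_notMem (mt (hmem N).1 h), min_eq_right (by lia), min_eq_right (by lia),
        add_zero]

theorem sum_mul_measure_superlevel_le_setLIntegral {X : Type*} [MeasurableSpace X] {ν : Measure X}
    {ψ : X → ℝ≥0} (hψ : Measurable ψ) {η : ℝ≥0} (hη : 0 < η) (E : Set X) (N : ℕ) :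
    ∑ k ∈ Finset.range N, η * ν (E ∩ ψ ⁻¹' Ici ((k + 1) * η)) ≤ ∫⁻ x in E, ψ x ∂ν := by
  have hmeas (k : ℕ) : MeasurableSet (ψ ⁻¹' Ici ((k + 1) * η)) := hψ measurableSet_Ici
  calc ∑ k ∈ Finset.range N, η * ν (E ∩ ψ ⁻¹' Ici ((k + 1) * η))
      = ∫⁻ x in E, ∑ k ∈ Finset.range N,
          (ψ ⁻¹' Ici ((k + 1) * η)).indicator (fun _ => (η : ℝ≥0∞)) x ∂ν := by
        rw [lintegral_finsetSum _ fun k _ => measurable_const.indicator (hmeas k)]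
        simp only [lintegral_indicator_const (hmeas _), Measure.restrict_apply (hmeas _),
          inter_comm]
    _ ≤ ∫⁻ x in E, ψ x ∂ν := by
        gcongr with x
        have hsum := sum_indicator_Ici_eq_min_mul hη N (ψ x)
        have hle : (min N ⌊ψ x / η⌋₊ : ℕ) * η ≤ ψ x := by
          rw [← le_div_iff₀ hη]
          exact (Nat.cast_le.2 (min_le_right _ _)).trans (Nat.floor_le zero_le)
        rw [← hsum, ← ENNReal.coe_le_coe] at hle
        push_cast [ENNReal.coe_indicator] at hle
        exact hle

variable {X : Type*} [PseudoMetricSpace X] {E : Set X} {ψ : X → ℝ≥0}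

theorem exists_eventually_le_add_sum_indicator_thickening (hE : IsCompact E) (hψ : Continuous ψ)
    {η : ℝ≥0} (hη : 0 < η) :
    ∃ N : ℕ, ∀ᶠ ε : ℝ in 𝓝[>] 0, ∀ y ∈ Metric.thickening ε E, ψ y ≤ 2 * η +
      ∑ k ∈ Finset.range N,
        (Metric.thickening ε (E ∩ ψ ⁻¹' Ici ((k + 1) * η))).indicator (fun _ => η) y := by
  obtain ⟨B, hB⟩ := (hE.image hψ).bddAbove
  obtain ⟨N, hN⟩ := exists_nat_ge (B / η)
  obtain ⟨δ, hδ, hδψ⟩ := Metric.mem_uniformity_dist.1 <|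
    hE.uniformContinuousAt_of_continuousAt ψ (fun x _ => hψ.continuousAt)
      (Metric.dist_mem_uniformity (NNReal.coe_pos.2 hη))
  refine ⟨N, ?_⟩
  filter_upwards [mem_nhdsWithin_of_mem_nhds (Iic_mem_nhds hδ)] with ε (hεδ : ε ≤ δ) y hy
  obtain ⟨x, hxE, hxy⟩ := Metric.mem_thickening_iff.1 hy
  have hnear : ψ y ≤ ψ x + η := by
    have hdist : dist (ψ x) (ψ y) < η := hδψ (by rw [dist_comm]; exact hxy.trans_le hεδ) hxE
    rw [NNReal.dist_eq, abs_lt] at hdist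
    exact_mod_cast (by linarith [hdist.1] : (ψ y : ℝ) ≤ ψ x + η)
  have hfloor : ⌊ψ x / η⌋₊ ≤ N :=
    Nat.floor_le_of_le ((div_le_div_of_nonneg_right (hB (mem_image_of_mem ψ hxE))
      zero_le).trans hN)
  have hlayer : ψ x ≤ η + ∑ k ∈ Finset.range N,
      (Ici ((k + 1) * η)).indicator (fun _ => η) (ψ x) := by
    rw [sum_indicator_Ici_eq_min_mul hη, min_eq_right hfloor, ← one_add_mul, add_comm (1 : ℝ≥0),
      ← div_le_iff₀ hη]
    exact (Nat.lt_floor_add_one _).le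
  have hind (k : ℕ) : (Ici ((k + 1) * η)).indicator (fun _ => η) (ψ x) ≤
      (Metric.thickening ε (E ∩ ψ ⁻¹' Ici ((k + 1) * η))).indicator (fun _ => η) y := by
    by_cases hk : ψ x ∈ Ici ((k + 1) * η)
    · have hy : y ∈ Metric.thickening ε (E ∩ ψ ⁻¹' Ici ((k + 1) * η)) :=
        Metric.mem_thickening_iff.2 ⟨x, ⟨hxE, hk⟩, hxy⟩
      rw [indicator_of_mem hk, indicator_of_mem hy]
    · rw [indicator_of_notMem hk]
      exact zero_le
  calc ψ y ≤ ψ x + η := hnear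
    _ ≤ (η + ∑ k ∈ Finset.range N, (Ici ((k + 1) * η)).indicator (fun _ => η) (ψ x)) + η := by
        gcongr
    _ ≤ (η + ∑ k ∈ Finset.range N, (Metric.thickening ε (E ∩ ψ ⁻¹' Ici ((k + 1) * η))).indicator
          (fun _ => η) y) + η := by
        gcongr with k
        exact hind k
    _ = _ := by ring

variable [MeasurableSpace X] [BorelSpace X] {μ ν : Measure X}

theorem exists_eventually_setLIntegral_thickening_le (hE : IsCompact E) (hψ : Continuous ψ)
    {η : ℝ≥0} (hη : 0 < η) :
    ∃ N : ℕ, ∀ᶠ ε : ℝ in 𝓝[>] 0, ∫⁻ x in Metric.thickening ε E, ψ x ∂μ ≤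
      2 * η * μ (Metric.thickening ε E) + ∑ k ∈ Finset.range N,
        η * μ (Metric.thickening ε (E ∩ ψ ⁻¹' Ici ((k + 1) * η))) := by
  obtain ⟨N, hN⟩ := exists_eventually_le_add_sum_indicator_thickening hE hψ hη
  refine ⟨N, hN.mono fun ε hε => ?_⟩
  have hmeas (k : ℕ) : MeasurableSet (Metric.thickening ε (E ∩ ψ ⁻¹' Ici ((k + 1) * η))) :=
    Metric.isOpen_thickening.measurableSet
  calc ∫⁻ x in Metric.thickening ε E, ψ x ∂μ
      ≤ ∫⁻ x in Metric.thickening ε E, (2 * η + ∑ k ∈ Finset.range N,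
          (Metric.thickening ε (E ∩ ψ ⁻¹' Ici ((k + 1) * η))).indicator (fun _ => (η : ℝ≥0∞)) x)
          ∂μ := by
        refine setLIntegral_mono' Metric.isOpen_thickening.measurableSet fun x hx => ?_
        have hx := ENNReal.coe_le_coe.2 (hε x hx)
        push_cast [ENNReal.coe_indicator] at hx
        exact hx
    _ ≤ _ := by
        rw [lintegral_add_left measurable_const, setLIntegral_const, lintegral_finsetSum _
          fun k _ => measurable_const.indicator (hmeas k)]
        gcongr with k
        rw [← lintegral_indicator_const (hmeas k)]
        exact setLIntegral_le_lintegral _ _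

theorem limsup_mul_setLIntegral_thickening_le_add (hE : IsCompact E) (hψ : Continuous ψ)
    {w : ℝ → ℝ≥0∞} {A : ℝ≥0}
    (h : ∀ S ⊆ E, IsCompact S →
      limsup (fun ε : ℝ => w ε * μ (Metric.thickening ε S)) (𝓝[>] 0) ≤ A * ν S)
    {η : ℝ≥0} (hη : 0 < η) :
    limsup (fun ε : ℝ => w ε * ∫⁻ x in Metric.thickening ε E, ψ x ∂μ) (𝓝[>] 0) ≤
      2 * η * (A * ν E) + A * ∫⁻ x in E, ψ x ∂ν := by
  obtain ⟨N, hN⟩ := exists_eventually_setLIntegral_thickening_le (μ := μ) hE hψ hη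
  let S (k : ℕ) : Set X := E ∩ ψ ⁻¹' Ici ((k + 1) * η)
  have hS (k : ℕ) : limsup (fun ε : ℝ => w ε * μ (Metric.thickening ε (S k))) (𝓝[>] 0) ≤
      A * ν (S k) :=
    h _ inter_subset_left (hE.inter_right (isClosed_Ici.preimage hψ))
  calc limsup (fun ε : ℝ => w ε * ∫⁻ x in Metric.thickening ε E, ψ x ∂μ) (𝓝[>] 0)
      ≤ limsup (fun ε : ℝ => 2 * η * (w ε * μ (Metric.thickening ε E)) +
          ∑ k ∈ Finset.range N, η * (w ε * μ (Metric.thickening ε (S k)))) (𝓝[>] 0) := by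
        refine limsup_le_limsup (hN.mono fun ε hε => ?_)
        beta_reduce
        grw [hε, mul_add, Finset.mul_sum]
        simp only [mul_left_comm (w ε), S, le_refl]
    _ ≤ 2 * η * (A * ν E) + ∑ k ∈ Finset.range N, η * (A * ν (S k)) := by
        grw [ennreal_limsup_add_le, ennreal_limsup_sum_le]
        simp only [ENNReal.limsup_const_mul_of_ne_top (ENNReal.coe_ne_top (r := η)),
          ENNReal.limsup_const_mul_of_ne_top (a := 2 * (η : ℝ≥0∞)) (by finiteness)]
        gcongr
        · exact h E subset_rfl hE
        · exact hS _
    _ ≤ 2 * η * (A * ν E) + A * ∫⁻ x in E, ψ x ∂ν := by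
        have hsum : ∑ k ∈ Finset.range N, η * (A * ν (S k)) =
            A * ∑ k ∈ Finset.range N, η * ν (S k) := by
          rw [Finset.mul_sum]
          exact Finset.sum_congr rfl fun k _ => mul_left_comm _ _ _
        grw [hsum, sum_mul_measure_superlevel_le_setLIntegral hψ.measurable hη E N]

theorem limsup_mul_setLIntegral_thickening_le [IsFiniteMeasureOnCompacts ν] (hE : IsCompact E)
    (hψ : Continuous ψ) {w : ℝ → ℝ≥0∞} {A : ℝ≥0}
    (h : ∀ S ⊆ E, IsCompact S →
      limsup (fun ε : ℝ => w ε * μ (Metric.thickening ε S)) (𝓝[>] 0) ≤ A * ν S) :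
    limsup (fun ε : ℝ => w ε * ∫⁻ x in Metric.thickening ε E, ψ x ∂μ) (𝓝[>] 0) ≤
      A * ∫⁻ x in E, ψ x ∂ν := by
  have hlim : Tendsto (fun η : ℝ≥0 => 2 * η * (A * ν E) + A * ∫⁻ x in E, ψ x ∂ν) (𝓝[>] 0)
      (𝓝 (A * ∫⁻ x in E, ψ x ∂ν)) := by
    have hcont : Continuous fun η : ℝ≥0 => 2 * (η : ℝ≥0∞) * (A * ν E) := by
      have hνE : A * ν E ≠ ∞ := ENNReal.mul_ne_top ENNReal.coe_ne_top hE.measure_lt_top.ne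
      simp only [mul_right_comm _ _ (A * ν E)]
      exact (ENNReal.continuous_const_mul (by finiteness)).comp ENNReal.continuous_coe
    simpa using ((hcont.tendsto 0).mono_left nhdsWithin_le_nhds).add_const _
  exact ge_of_tendsto hlim <| eventually_mem_nhdsWithin.mono fun _ hη =>
    limsup_mul_setLIntegral_thickening_le_add hE hψ h hη

end Thickening

section Minkowski

variable {n : ℕ} {α : ℝ} {E S T : Set (EuclideanSpace ℝ (Fin n))}
  {ν : Measure (EuclideanSpace ℝ (Fin n))} {A : ℝ≥0}

theorem upperMinkowskiContent_mono (h : S ⊆ T) :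
    upperMinkowskiContent α S ≤ upperMinkowskiContent α T := by
  refine limsup_le_limsup (Eventually.of_forall fun ε => ?_)
  beta_reduce
  grw [Metric.thickening_subset_of_subset ε h]

theorem upperMinkowskiContent_singleton (hα : 0 < α) (x : EuclideanSpace ℝ (Fin n)) :
    upperMinkowskiContent α {x} = 0 := by
  let c : ℝ≥0∞ := volume (Metric.ball (0 : EuclideanSpace ℝ (Fin n)) 1)
  have hc : c ≠ ∞ := measure_ball_lt_top.ne
  have hpow : Tendsto (fun ε : ℝ => (2 : ℝ) ^ (α - n) * ε ^ α) (𝓝[>] 0) (𝓝 0) := by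
    have hcont : Continuous fun ε : ℝ => (2 : ℝ) ^ (α - n) * ε ^ α :=
      (Real.continuous_rpow_const hα.le).const_mul _
    simpa [Real.zero_rpow hα.ne'] using (hcont.tendsto 0).mono_left nhdsWithin_le_nhds
  have hlim : Tendsto (fun ε : ℝ => ENNReal.ofReal ((2 : ℝ) ^ (α - n) * ε ^ α) * c)
      (𝓝[>] 0) (𝓝 0) := by
    simpa using ENNReal.Tendsto.mul_const (ENNReal.tendsto_ofReal hpow) (.inr hc)
  refine (hlim.congr' ?_).limsup_eq
  filter_upwards [self_mem_nhdsWithin] with ε (hε : 0 < ε)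
  have hscale : (2 : ℝ) ^ (α - n) * ε ^ α = (2 * ε) ^ (α - n) * ε ^ n := by
    rw [Real.mul_rpow zero_le_two hε.le, mul_assoc, ← Real.rpow_natCast, ← Real.rpow_add hε,
      sub_add_cancel]
  rw [Metric.thickening_singleton, Measure.addHaar_ball_of_pos _ _ hε, finrank_euclideanSpace_fin,
    ← mul_assoc, ← ENNReal.ofReal_mul (by positivity), hscale]

-- Enlarge a null set `S` by a small ball of positive measure around a point of the support of `ν`:
-- points are `ν`-null because their Minkowski content vanishes.
theorem upperMinkowskiContent_le_of_pos [IsFiniteMeasureOnCompacts ν] (hα : 0 < α)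
    (hE : IsCompact E) (hνE : ν E ≠ 0)
    (h : ∀ S ⊆ E, IsCompact S → ν S ≠ 0 →
      0 < upperMinkowskiContent α S ∧ upperMinkowskiContent α S ≤ A * ν S)
    (hSE : S ⊆ E) (hS : IsCompact S) : upperMinkowskiContent α S ≤ A * ν S := by
  by_cases hνS : ν S = 0
  swap
  · exact (h S hSE hS hνS).2
  have hrestrict (r : ℝ) (x) :
      ν.restrict E (Metric.cthickening r {x}) = ν (E ∩ Metric.cthickening r {x}) := by
    rw [Measure.restrict_apply Metric.isClosed_cthickening.measurableSet, inter_comm]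
  obtain ⟨x, hxE, hx⟩ : (E ∩ (ν.restrict E).support).Nonempty :=
    Measure.nonempty_inter_support_of_pos (by simpa [pos_iff_ne_zero] using hνE)
  have hatom : ν {x} = 0 := by
    by_contra hνx
    exact (h {x} (singleton_subset_iff.2 hxE) isCompact_singleton hνx).1.ne'
      (upperMinkowskiContent_singleton hα x)
  have hlim : Tendsto (fun r => A * ν (E ∩ Metric.cthickening r {x})) (𝓝[>] 0) (𝓝 (A * ν S)) := by
    have : IsFiniteMeasure (ν.restrict E) := isFiniteMeasure_restrict.2 hE.measure_lt_top.ne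
    have hball := (tendsto_measure_cthickening_of_isClosed (μ := ν.restrict E)
      ⟨1, one_pos, measure_ne_top _ _⟩ (isClosed_singleton (x := x))).mono_left
      (nhdsWithin_le_nhds (s := Ioi 0))
    simp only [hrestrict, Measure.restrict_apply (measurableSet_singleton x),
      measure_mono_null inter_subset_left hatom] at hball
    simpa [hνS] using ENNReal.Tendsto.const_mul hball (.inr ENNReal.coe_ne_top)
  refine ge_of_tendsto hlim ?_
  filter_upwards [self_mem_nhdsWithin] with r (hr : 0 < r)
  have hball : ν (E ∩ Metric.cthickening r {x}) ≠ 0 := by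
    rw [← hrestrict, Metric.cthickening_singleton _ hr.le]
    exact ((Measure.mem_support_iff_forall x).1 hx _ (Metric.closedBall_mem_nhds x hr)).ne'
  have hunion : ν (S ∪ E ∩ Metric.cthickening r {x}) = ν (E ∩ Metric.cthickening r {x}) :=
    measure_congr (union_ae_eq_right_of_ae_eq_empty (ae_eq_empty.2 hνS))
  calc upperMinkowskiContent α S
      ≤ upperMinkowskiContent α (S ∪ E ∩ Metric.cthickening r {x}) :=
        upperMinkowskiContent_mono subset_union_left
    _ ≤ A * ν (E ∩ Metric.cthickening r {x}) := by
        rw [← hunion]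
        exact (h _ (union_subset hSE inter_subset_left)
          (hS.union (hE.inter_right Metric.isClosed_cthickening)) (by rwa [hunion])).2

theorem limsup_inv_rpow_mul_volume_thickening (α : ℝ) (S : Set (EuclideanSpace ℝ (Fin n))) :
    limsup (fun ε : ℝ => ENNReal.ofReal (ε⁻¹ ^ (n - α)) * volume (Metric.thickening ε S))
      (𝓝[>] 0) = ENNReal.ofReal (2 ^ (n - α)) * upperMinkowskiContent α S := by
  rw [upperMinkowskiContent, ← ENNReal.limsup_const_mul_of_ne_top ENNReal.ofReal_ne_top]
  refine limsup_congr ?_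
  filter_upwards [self_mem_nhdsWithin] with ε (hε : 0 < ε)
  have hpow : (2 : ℝ) ^ (n - α) * (2 * ε) ^ (α - n) = ε⁻¹ ^ (n - α) := by
    rw [← neg_sub (n : ℝ) α, Real.rpow_neg (by positivity), Real.mul_rpow zero_le_two hε.le,
      Real.inv_rpow hε.le, mul_inv, mul_inv_cancel_left₀ (by positivity)]
  rw [← mul_assoc, ← ENNReal.ofReal_mul (by positivity), hpow]

theorem limsup_setLIntegral_thickening_enorm_sq_le [IsFiniteMeasureOnCompacts ν] {F : Type*}
    [SeminormedAddCommGroup F] (hE : IsCompact E)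
    (hA : ∀ S ⊆ E, IsCompact S → upperMinkowskiContent α S ≤ A * ν S)
    {φ : EuclideanSpace ℝ (Fin n) → F} (hφ : Continuous φ) :
    limsup (fun ε : ℝ => ENNReal.ofReal (ε⁻¹ ^ (n - α)) *
      ∫⁻ x in Metric.thickening ε E, ‖φ x‖ₑ ^ 2) (𝓝[>] 0) ≤
      ENNReal.ofReal (2 ^ (n - α)) * A * ∫⁻ x in E, ‖φ x‖ₑ ^ 2 ∂ν := by
  have h := limsup_mul_setLIntegral_thickening_le (μ := volume) (ν := ν) hE
    (hφ.nnnorm.pow 2) (w := fun ε => ENNReal.ofReal (ε⁻¹ ^ (n - α)))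
    (A := Real.toNNReal (2 ^ (n - α)) * A) fun S hSE hS => by
      rw [limsup_inv_rpow_mul_volume_thickening, ENNReal.coe_mul, mul_assoc]
      exact mul_le_mul_right (hA S hSE hS) _
  simpa [ENNReal.ofReal, enorm_eq_nnnorm] using h

end Minkowski

section Density

variable {V : Type*} [NormedAddCommGroup V] [NormedSpace ℝ V] [FiniteDimensional ℝ V]
  [MeasurableSpace V] [BorelSpace V] {ν : Measure V} [ν.HasTemperateGrowth]
  [IsFiniteMeasureOnCompacts ν] {u : 𝓢'(V, ℂ)}

theorem exists_Lp_inner_toLp_eq {R : ℝ≥0} (h : ∀ φ, ‖u φ‖ ≤ R * ‖φ.toLp 2 ν‖) :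
    ∃ w : Lp ℂ 2 ν, ‖w‖ ≤ R ∧ ∀ φ, u φ = inner ℂ w (φ.toLp 2 ν) := by
  let T := SchwartzMap.toLpCLM ℂ (E := V) ℂ 2 ν
  have hT : DenseRange T := denseRange_toLpCLM ENNReal.ofNat_ne_top
  let G := LinearMap.extendOfNorm u.toLinearMap T.toLinearMap
  refine ⟨(InnerProductSpace.toDual ℂ (Lp ℂ 2 ν)).symm G, ?_, fun φ => ?_⟩
  · rw [LinearIsometryEquiv.norm_map]
    exact LinearMap.opNorm_extendOfNorm_le hT R.coe_nonneg h
  · rw [InnerProductSpace.toDual_symm_apply]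
    exact (LinearMap.extendOfNorm_eq hT ⟨R, h⟩ φ).symm

theorem exists_density_of_enorm_sq_le {K : ℝ≥0∞} (hK : K ≠ ∞)
    (h : ∀ φ : 𝓢(V, ℂ), ‖u φ‖ₑ ^ 2 ≤ K * ∫⁻ x, ‖φ x‖ₑ ^ 2 ∂ν) :
    ∃ u₀ : V → ℂ, MemLp u₀ 2 ν ∧ (∀ φ : 𝓢(V, ℂ), u φ = ∫ x, φ x * u₀ x ∂ν) ∧
      ∫⁻ x, ‖u₀ x‖ₑ ^ 2 ∂ν ≤ K := by
  lift K to ℝ≥0 using hK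
  have hbound (φ : 𝓢(V, ℂ)) : ‖u φ‖ ≤ NNReal.sqrt K * ‖φ.toLp 2 ν‖ := by
    have hφ := h φ
    rw [← enorm_sq_toLp, enorm_eq_nnnorm, enorm_eq_nnnorm] at hφ
    rw [← coe_nnnorm, ← coe_nnnorm, ← NNReal.coe_mul, NNReal.coe_le_coe,
      ← pow_le_pow_iff_left₀ zero_le zero_le two_ne_zero, mul_pow, NNReal.sq_sqrt]
    exact_mod_cast hφ
  obtain ⟨w, hw, huw⟩ := exists_Lp_inner_toLp_eq hbound
  refine ⟨star w, (Lp.memLp w).star, fun φ => ?_, ?_⟩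
  · rw [huw, L2.inner_def]
    refine integral_congr_ae ?_
    filter_upwards [φ.coeFn_toLp 2 ν] with x hx
    simp [hx]
  · have hwK : ‖w‖₊ ^ 2 ≤ K := by
      rw [← NNReal.sq_sqrt K]
      gcongr
      exact hw
    have hstar (x : V) : ‖(star w : V → ℂ) x‖ₑ = ‖w x‖ₑ := by simp [enorm_eq_nnnorm]
    simp only [hstar]
    rw [← enorm_sq_eq_lintegral, enorm_eq_nnnorm]
    exact_mod_cast hwK

end Density

section Holder

variable {F : Type*} [NormedAddCommGroup F] {p : ℝ}

theorem lintegral_enorm_sq_le_rpow_mul_measure_univ {X : Type*} [MeasurableSpace X] {μ : Measure X}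
    {f : X → F} (hf : AEStronglyMeasurable f μ) (hp : 2 ≤ p) :
    ∫⁻ x, ‖f x‖ₑ ^ 2 ∂μ ≤ (∫⁻ x, ‖f x‖ₑ ^ p ∂μ) ^ (2 / p) * μ univ ^ (1 - 2 / p) := by
  have hp0 : 0 < p := two_pos.trans_le hp
  have hHölder := ENNReal.lintegral_mul_norm_pow_le (hf.enorm.pow_const p)
    (aemeasurable_const (b := 1)) (div_nonneg zero_le_two hp0.le)
    (sub_nonneg.2 ((div_le_one hp0).2 hp)) (add_sub_cancel _ _)
  simpa [← ENNReal.rpow_mul, mul_div_cancel₀ _ hp0.ne'] using hHölder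

theorem HasBallGrowth.withDensity_enorm_sq {V : Type*} [NormedAddCommGroup V] [NormedSpace ℝ V]
    [FiniteDimensional ℝ V] [MeasurableSpace V] [BorelSpace V] {μ : Measure V}
    [μ.IsAddHaarMeasure] {f : V → F} {α : ℝ} {K : ℝ≥0∞}
    (h : HasBallGrowth (μ.withDensity fun ξ => ‖f ξ‖ₑ ^ p) (Module.finrank ℝ V - α * p / 2) K)
    (hf : AEStronglyMeasurable f μ) (hp : 2 ≤ p) :
    HasBallGrowth (μ.withDensity fun ξ => ‖f ξ‖ₑ ^ 2) (Module.finrank ℝ V - α)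
      (K ^ (2 / p) * μ (Metric.ball 0 1) ^ (1 - 2 / p)) := by
  have hp0 : 0 < p := two_pos.trans_le hp
  have hs : 0 ≤ 2 / p := by positivity
  have ht : 0 ≤ 1 - 2 / p := sub_nonneg.2 ((div_le_one hp0).2 hp)
  filter_upwards [h, eventually_gt_atTop 0] with L hL hL0
  have hball : MeasurableSet (Metric.closedBall (0 : V) L) :=
    Metric.isClosed_closedBall.measurableSet
  have hexp : L ^ (Module.finrank ℝ V - α) =
      (L ^ (Module.finrank ℝ V - α * p / 2)) ^ (2 / p) *
        (L ^ Module.finrank ℝ V) ^ (1 - 2 / p) := by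
    rw [← Real.rpow_natCast, ← Real.rpow_mul hL0.le, ← Real.rpow_mul hL0.le, ← Real.rpow_add hL0]
    congr 1
    field_simp
    ring
  rw [withDensity_apply _ hball] at hL ⊢
  grw [lintegral_enorm_sq_le_rpow_mul_measure_univ hf.restrict hp, hL]
  rw [Measure.restrict_apply_univ, Measure.addHaar_closedBall _ _ hL0.le, hexp,
    ENNReal.mul_rpow_of_nonneg _ _ hs, ENNReal.mul_rpow_of_nonneg _ _ ht,
    ENNReal.ofReal_rpow_of_nonneg (by positivity) hs,
    ENNReal.ofReal_rpow_of_nonneg (by positivity) ht, ENNReal.ofReal_mul (by positivity)]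
  apply le_of_eq
  ring

end Holder

section FourierLimsup

variable {n : ℕ} {u : 𝓢'(EuclideanSpace ℝ (Fin n), ℂ)} {α p : ℝ}

theorem exists_isFunctionDistribution_of_fourierLimsup_lt_top (h : fourierLimsup u α p < ∞) :
    ∃ f, IsFunctionDistribution (𝓕 u) f := by
  by_contra! hf
  have htop (L : ℝ) : lpMassOnBall (𝓕 u) p L = ∞ := by simp [lpMassOnBall, hf]
  simp [fourierLimsup, htop, ENNReal.top_div_of_ne_top] at h

theorem IsFunctionDistribution.hasBallGrowth {f : EuclideanSpace ℝ (Fin n) → ℂ}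
    (hf : IsFunctionDistribution (𝓕 u) f) {K : ℝ≥0∞} (hK : fourierLimsup u α p < K) :
    HasBallGrowth (volume.withDensity fun ξ => ‖f ξ‖ₑ ^ p) (n - α * p / 2) K := by
  filter_upwards [eventually_lt_of_limsup_lt hK, eventually_gt_atTop 0] with L hL hL0
  rw [withDensity_apply _ Metric.isClosed_closedBall.measurableSet, ← hf.lpMassOnBall_eq]
  exact (ENNReal.div_le_iff (ENNReal.ofReal_pos.2 (by positivity)).ne'
    ENNReal.ofReal_ne_top).1 hL.le

theorem exists_enorm_apply_sq_le_of_fourierLimsup_lt (n : ℕ) (α p : ℝ) (hp : 2 ≤ p) (A : ℝ≥0) :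
    ∃ C : ℝ≥0, ∀ (E : Set (EuclideanSpace ℝ (Fin n))) (ν : Measure (EuclideanSpace ℝ (Fin n)))
      [IsFiniteMeasureOnCompacts ν], IsCompact E →
      (∀ S ⊆ E, IsCompact S → upperMinkowskiContent α S ≤ A * ν S) →
      ∀ u : 𝓢'(EuclideanSpace ℝ (Fin n), ℂ), Distribution.dsupport u ⊆ E →
        ∀ K : ℝ≥0∞, K ≠ ∞ → fourierLimsup u α p < K → ∀ φ : 𝓢(EuclideanSpace ℝ (Fin n), ℂ),
        ‖u φ‖ₑ ^ 2 ≤ C * K ^ (2 / p) * ∫⁻ x in E, ‖φ x‖ₑ ^ 2 ∂ν := by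
  have hp0 : 0 < p := two_pos.trans_le hp
  obtain ⟨C, hC⟩ := exists_enorm_apply_sq_le_limsup (EuclideanSpace ℝ (Fin n)) (n - α)
  let B := volume (Metric.ball (0 : EuclideanSpace ℝ (Fin n)) 1) ^ (1 - 2 / p)
  have hB : B ≠ ∞ := ENNReal.rpow_ne_top_of_nonneg
    (sub_nonneg.2 ((div_le_one hp0).2 hp)) measure_ball_lt_top.ne
  refine ⟨C * B.toNNReal * (Real.toNNReal (2 ^ (n - α)) * A),
    fun E ν _ hE hA u hu K hK hFK φ => ?_⟩
  obtain ⟨f, hf⟩ := exists_isFunctionDistribution_of_fourierLimsup_lt_top (hFK.trans_le le_top)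
  have hgrowth : HasBallGrowth (volume.withDensity fun ξ => ‖f ξ‖ₑ ^ 2) (n - α)
      (K ^ (2 / p) * B) := by
    have hdim : (Module.finrank ℝ (EuclideanSpace ℝ (Fin n)) : ℝ) = n := by
      rw [finrank_euclideanSpace_fin]
    rw [← hdim]
    exact HasBallGrowth.withDensity_enorm_sq (by simpa only [hdim] using hf.hasBallGrowth hFK)
      hf.1.aestronglyMeasurable hp
  have hM : K ^ (2 / p) * B ≠ ∞ :=
    ENNReal.mul_ne_top (ENNReal.rpow_ne_top_of_nonneg (by positivity) hK) hB
  grw [hC u f (hf.isTemperedFunction hM hgrowth) _ hM hgrowth E hE hu φ,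
    limsup_setLIntegral_thickening_enorm_sq_le hE hA φ.continuous]
  rw [ENNReal.coe_mul, ENNReal.coe_mul, ENNReal.coe_mul, ENNReal.coe_toNNReal hB, ENNReal.ofReal]
  apply le_of_eq
  ring

theorem exists_enorm_apply_sq_le_fourierLimsup_rpow (n : ℕ) (α p : ℝ) (hp : 2 ≤ p) (A : ℝ≥0) :
    ∃ C : ℝ≥0, ∀ (E : Set (EuclideanSpace ℝ (Fin n))) (ν : Measure (EuclideanSpace ℝ (Fin n)))
      [IsFiniteMeasureOnCompacts ν], IsCompact E →
      (∀ S ⊆ E, IsCompact S → upperMinkowskiContent α S ≤ A * ν S) →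
      ∀ u : 𝓢'(EuclideanSpace ℝ (Fin n), ℂ), Distribution.dsupport u ⊆ E →
        fourierLimsup u α p < ∞ → ∀ φ : 𝓢(EuclideanSpace ℝ (Fin n), ℂ),
        ‖u φ‖ₑ ^ 2 ≤ C * fourierLimsup u α p ^ (2 / p) * ∫⁻ x in E, ‖φ x‖ₑ ^ 2 ∂ν := by
  obtain ⟨C, hC⟩ := exists_enorm_apply_sq_le_of_fourierLimsup_lt n α p hp A
  refine ⟨C, fun E ν _ hE hA u hu hfin φ => ?_⟩
  have : IsFiniteMeasure (ν.restrict E) := isFiniteMeasure_restrict.2 hE.measure_lt_top.ne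
  have hI : ∫⁻ x in E, ‖φ x‖ₑ ^ 2 ∂ν ≠ ∞ := by
    rw [← enorm_sq_toLp]
    finiteness
  have hlim : Tendsto (fun K : ℝ≥0∞ => C * K ^ (2 / p) * ∫⁻ x in E, ‖φ x‖ₑ ^ 2 ∂ν)
      (𝓝[>] fourierLimsup u α p)
      (𝓝 (C * fourierLimsup u α p ^ (2 / p) * ∫⁻ x in E, ‖φ x‖ₑ ^ 2 ∂ν)) :=
    ((ENNReal.continuous_mul_const hI).comp <| (ENNReal.continuous_const_mul
      ENNReal.coe_ne_top).comp ENNReal.continuous_rpow_const).tendsto' _ _ rfl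
      |>.mono_left nhdsWithin_le_nhds
  have : (𝓝[>] fourierLimsup u α p).NeBot := nhdsGT_neBot_of_exists_gt ⟨∞, hfin⟩
  refine ge_of_tendsto hlim ?_
  filter_upwards [Ioo_mem_nhdsGT hfin] with K hK
  exact hC E ν hE hA u hu K hK.2.ne hK.1 φ

theorem exists_density_of_upperMinkowskiContent_le (n : ℕ) (α p : ℝ) (hp : 2 ≤ p) (A : ℝ≥0) :
    ∃ C : ℝ≥0, ∀ (E : Set (EuclideanSpace ℝ (Fin n))) (ν : Measure (EuclideanSpace ℝ (Fin n)))
      [IsFiniteMeasureOnCompacts ν], IsCompact E →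
      (∀ S ⊆ E, IsCompact S → upperMinkowskiContent α S ≤ A * ν S) →
      ∀ u : 𝓢'(EuclideanSpace ℝ (Fin n), ℂ), Distribution.dsupport u ⊆ E →
        fourierLimsup u α p < ∞ →
        ∃ u₀ : EuclideanSpace ℝ (Fin n) → ℂ, MemLp u₀ 2 (ν.restrict E) ∧
          (∀ φ : 𝓢(EuclideanSpace ℝ (Fin n), ℂ), u φ = ∫ x in E, φ x * u₀ x ∂ν) ∧
          (∫⁻ x in E, ‖u₀ x‖ₑ ^ 2 ∂ν) ^ (p / 2) ≤ C * fourierLimsup u α p := by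
  have hp0 : 0 < p := two_pos.trans_le hp
  obtain ⟨C, hC⟩ := exists_enorm_apply_sq_le_fourierLimsup_rpow n α p hp A
  refine ⟨C ^ (p / 2), fun E ν _ hE hA u hu hfin => ?_⟩
  have : IsFiniteMeasure (ν.restrict E) := isFiniteMeasure_restrict.2 hE.measure_lt_top.ne
  obtain ⟨u₀, hu₀, hrepr, hnorm⟩ := exists_density_of_enorm_sq_le
    (by finiteness) (hC E ν hE hA u hu hfin)
  refine ⟨u₀, hu₀, hrepr, ?_⟩
  grw [hnorm]
  have hexp : 2 / p * (p / 2) = 1 := by rw [← inv_div, inv_mul_cancel₀ (half_pos hp0).ne']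
  rw [ENNReal.mul_rpow_of_nonneg _ _ (by positivity), ← ENNReal.rpow_mul, hexp, ENNReal.rpow_one,
    ENNReal.coe_rpow_of_nonneg _ (by positivity)]

end FourierLimsup

theorem theorem2p9_general (n : ℕ) (α p : ℝ) (hα : 0 < α) (hp : 2 ≤ p) (A : ℝ≥0) :
    ∃ C : ℝ≥0, ∀ (E : Set (EuclideanSpace ℝ (Fin n))) (ν : Measure (EuclideanSpace ℝ (Fin n)))
      [IsFiniteMeasureOnCompacts ν], IsCompact E → ν E ≠ 0 →
      (∀ S ⊆ E, IsCompact S → ν S ≠ 0 →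
        0 < upperMinkowskiContent α S ∧ upperMinkowskiContent α S ≤ A * ν S) →
      ∀ u : 𝓢'(EuclideanSpace ℝ (Fin n), ℂ), Distribution.dsupport u ⊆ E →
        fourierLimsup u α p < ∞ →
        ∃ u₀ : EuclideanSpace ℝ (Fin n) → ℂ, MemLp u₀ 2 (ν.restrict E) ∧
          (∀ φ : 𝓢(EuclideanSpace ℝ (Fin n), ℂ), u φ = ∫ x in E, φ x * u₀ x ∂ν) ∧
          (∫⁻ x in E, ‖u₀ x‖ₑ ^ 2 ∂ν) ^ (p / 2) ≤ C * fourierLimsup u α p := by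
  obtain ⟨C, hC⟩ := exists_density_of_upperMinkowskiContent_le n α p hp A
  exact ⟨C, fun E ν _ hE hνE hA =>
    hC E ν hE fun _ hSE hS => upperMinkowskiContent_le_of_pos hα hE hνE hA hSE hS⟩

theorem theorem2p9 (n : ℕ) (α p : ℝ) (hα : 0 < α) (hαn : α < n)
    (hp : 2 ≤ p) (hpα : p < 2 * n / α) (A : ℝ≥0) :
    ∃ C : ℝ≥0, ∀ (E : Set (EuclideanSpace ℝ (Fin n))) (ν : Measure (EuclideanSpace ℝ (Fin n)))
      [IsFiniteMeasure ν], IsCompact E → ν Eᶜ = 0 → ν ≠ 0 →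
      (∀ S ⊆ E, IsCompact S → ν S ≠ 0 →
        0 < upperMinkowskiContent α S ∧ upperMinkowskiContent α S ≤ A * ν S) →
      ∀ u : 𝓢'(EuclideanSpace ℝ (Fin n), ℂ), Distribution.dsupport u ⊆ E →
        fourierLimsup u α p < ∞ →
        ∃ u₀ : EuclideanSpace ℝ (Fin n) → ℂ, MemLp u₀ 2 ν ∧
          (∀ φ : 𝓢(EuclideanSpace ℝ (Fin n), ℂ), u φ = ∫ x in E, φ x * u₀ x ∂ν) ∧
          (∫⁻ x in E, ‖u₀ x‖ₑ ^ 2 ∂ν) ^ (p / 2) ≤ C * fourierLimsup u α p := by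
  obtain ⟨C, hC⟩ := theorem2p9_general n α p hα hp A
  refine ⟨C, fun E ν _ hE hνE hν => ?_⟩
  have hrestrict : ν.restrict E = ν := Measure.restrict_eq_self_of_ae_mem hνE
  have hν_ne_zero : ν E ≠ 0 := by rwa [Ne, ← Measure.restrict_eq_zero, hrestrict]
  simpa only [hrestrict] using hC E ν hE hν_ne_zero
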